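/- Let $E_k$ be the number of up-down permutations of $\{1,\dots,k\}$, i.e. permutations $a_1a_2\cdots a_k$ with $a_1<a_2>a_3<a_4>\cdots$; the numbers $E_{2n-1}$ are the tangent numbers. For a skew shape $\lambda/\mu$ let $f^{\lambda/\mu}$ be the number of standard Young tableaux of shape $\lambda/\mu$, i.e. of bijective fillings of its boxes with $1,2,\dots,|\lambda/\mu|$ that increase along rows (left to right) and along columns (top to bottom). For $n\ge 1$ let $$\sigma_{3n-2}=(n,n,n-1,n-2,\dots,3,2)/(n-2,n-3,\dots,1,0,0),$$ $$\sigma_{3n-1}=(n,n,n,n-1,n-2,\dots,3,2)/(n-1,n-2,\dots,1,0,0),$$ $$\sigma_{3n}=(n,n,n,n-1,\dots,3,2,1)/(n-1,n-2,\dots,1,0,0,0)$$ be the three $3$-strip shapes, with $3n-2$, $3n-1$ and $3n$ boxes respectively; the small cases are $\sigma_1=(1)$, $\sigma_2=(1,1)$, $\sigma_3=(1,1,1)$, $\sigma_4=(2,2)$, $\sigma_5=(2,2,2)/(1,0,0)$, $\sigma_6=(2,2,2,1)/(1,0,0,0)$. Then, for all $n\ge 1$, $$f^{\sigma_{3n-2}}=\frac{(3n-2)!\,E_{2n-1}}{(2n-1)!\,2^{2n-2}},\qquad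 f^{\sigma_{3n-1}}=\frac{(3n-1)!\,E_{2n-1}}{(2n-1)!\,2^{2n-1}},\qquad f^{\sigma_{3n}}=\frac{(3n)!\,(2^{2n-1}-1)\,E_{2n-1}}{(2n-1)!\,2^{2n-1}\,(2^{2n}-1)}.$$ Moreover, as formal power series over $\mathbb{Q}$, $$\sum_{n\ge 1}\frac{f^{\sigma_{3n-1}}}{(3n-1)!}\,x^{2n}=x\tan\left(\frac{x}{2}\right),\qquad \sum_{n\ge 1}\frac{f^{\sigma_{3n}}}{(3n)!}\,x^{2n}=\frac{x}{\sin x}-1.$$ -/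

import Mathlib

namespace ThreeStrip

/-- `w` is an up-down permutation: `w₁ < w₂ > w₃ < w₄ > ⋯`. Positions and values are indexed from
`0` here, so the ascents are at the even indices. -/
def IsUpDown {n : ℕ} (w : Equiv.Perm (Fin n)) : Prop :=
  ∀ (i : ℕ) (hi : i + 1 < n),
    (Even i → w ⟨i, Nat.lt_of_succ_lt hi⟩ < w ⟨i + 1, hi⟩) ∧
    (Odd i → w ⟨i + 1, hi⟩ < w ⟨i, Nat.lt_of_succ_lt hi⟩)

/-- The Euler number `E_n`: the number of up-down permutations of `n` letters. -/
noncomputable def eulerNumber (n : ℕ) : ℕ :=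
  Nat.card {w : Equiv.Perm (Fin n) // IsUpDown w}

/-- The boxes of the skew diagram `lam / mu`. The box `(i, j)` is in row `i` (counted from the top)
and in column `j` (counted from the left). -/
def skewCells (lam mu : YoungDiagram) : Finset (ℕ × ℕ) :=
  lam.cells \ mu.cells

/-- A bijective filling of a finite set `D` of boxes with `1, 2, …, |D|` is standard if it increases
along rows (from left to right) and along columns (from top to bottom). -/
def IsStandard (D : Finset (ℕ × ℕ)) (T : D ≃ Finset.Icc 1 D.card) : Prop :=
  (∀ a b : D, a.1.1 = b.1.1 → a.1.2 < b.1.2 → T a < T b) ∧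
  (∀ a b : D, a.1.2 = b.1.2 → a.1.1 < b.1.1 → T a < T b)

/-- `f^{lam / mu}`: the number of standard Young tableaux of skew shape `lam / mu`. -/
noncomputable def numSYT (lam mu : YoungDiagram) : ℕ :=
  Nat.card {T : skewCells lam mu ≃ Finset.Icc 1 (skewCells lam mu).card //
    IsStandard (skewCells lam mu) T}

/-- The list `a, a - 1, …, b + 1, b`, empty if `a < b`. -/
def down (a b : ℕ) : List ℕ := (List.range' b (a + 1 - b)).reverse

theorem mem_down {a b x : ℕ} : x ∈ down a b ↔ b ≤ x ∧ x ≤ a := by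
  simp only [down, List.mem_reverse, List.mem_range'_1]
  omega

theorem pairwise_down (a b : ℕ) : (down a b).Pairwise (· ≥ ·) := by
  rw [down, List.pairwise_reverse]
  exact (List.pairwise_lt_range' (s := b) (n := a + 1 - b)).imp fun h => le_of_lt h

theorem sorted_append_zeros (a k : ℕ) : (down a 1 ++ List.replicate k 0).SortedGE := by
  rw [List.sortedGE_iff_pairwise, List.pairwise_append]
  refine ⟨pairwise_down _ _, List.pairwise_replicate.2 (Or.inr le_rfl), ?_⟩
  intro x _ y hy
  rw [List.eq_of_mem_replicate hy]
  exact Nat.zero_le x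

theorem sorted_replicate_append (n k b : ℕ) : (List.replicate k n ++ down n b).SortedGE := by
  rw [List.sortedGE_iff_pairwise, List.pairwise_append]
  refine ⟨List.pairwise_replicate.2 (Or.inr le_rfl), pairwise_down _ _, ?_⟩
  intro x hx y hy
  rw [List.eq_of_mem_replicate hx]
  exact (mem_down.1 hy).2

/-- The partition with `k` parts `n`, followed by the parts `n, n - 1, …, b` (none if `n < b`). -/
def outerShape (k n b : ℕ) : YoungDiagram :=
  YoungDiagram.ofRowLens (List.replicate k n ++ down n b) (sorted_replicate_append n k b)

/-- The partition `(a, a - 1, …, 1, 0, …, 0)`, padded with `k` trailing zeros. -/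
def innerShape (a k : ℕ) : YoungDiagram :=
  YoungDiagram.ofRowLens (down a 1 ++ List.replicate k 0) (sorted_append_zeros a k)

/-- `f^{σ_{3n-2}}` for `n ≥ 1`, where
`σ_{3n-2} = (n, n, n-1, n-2, …, 3, 2) / (n-2, n-3, …, 1, 0, 0)`
(so `σ_1 = (1)` and `σ_4 = (2, 2)`). -/
noncomputable def fSigma2 (n : ℕ) : ℕ := numSYT (outerShape 1 n 2) (innerShape (n - 2) 2)

/-- `f^{σ_{3n-1}}` for `n ≥ 1`, where
`σ_{3n-1} = (n, n, n, n-1, n-2, …, 3, 2) / (n-1, n-2, …, 1, 0, 0)`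
(so `σ_2 = (1, 1)` and `σ_5 = (2, 2, 2) / (1, 0, 0)`). -/
noncomputable def fSigma1 (n : ℕ) : ℕ := numSYT (outerShape 2 n 2) (innerShape (n - 1) 2)

/-- `f^{σ_{3n}}` for `n ≥ 1`, where
`σ_{3n} = (n, n, n, n-1, …, 3, 2, 1) / (n-1, n-2, …, 1, 0, 0, 0)`
(so `σ_3 = (1, 1, 1)` and `σ_6 = (2, 2, 2, 1) / (1, 0, 0, 0)`). -/
noncomputable def fSigma0 (n : ℕ) : ℕ := numSYT (outerShape 2 n 1) (innerShape (n - 1) 3)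

/-- The formal power series `∑_{n ≥ 1} c n * x ^ (2 n)`. -/
noncomputable def evenSeries (c : ℕ → ℚ) : PowerSeries ℚ :=
  PowerSeries.mk fun k => if Even k ∧ 1 ≤ k then c (k / 2) else 0

end ThreeStrip

/-!
Labelling the elements of a poset by the relative order of independent uniform coordinates shows
that the number of standard Young tableaux of a shape with `N` boxes is `N!` times the volume of
its order polytope. The same holds for up-down permutations and the zigzag poset.

In a `3`-strip the boxes of the middle antidiagonal have no relations among themselves, and each
remaining box is related only to one or two consecutive middle boxes. Integrating the remaining
coordinates out turns the volume into `∫ K ^ m g · h`, where `K` is the integral operator on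
`[0, 1]` with kernel `min x y * (1 - max x y)`, the Green's function of `-d² / dx²` with Dirichlet
boundary conditions. Since `u = sin (t x) / sin t` satisfies `u = x + t² K u`, the functions
`K ^ m x` are the coefficients of the powers of `t²` in `u`; likewise `cos (t x) / cos t` gives the
iterates of `1` under the kernel `1 - max x y` of the zigzag poset. Integrating over `x` yields, up
to powers of `t`, the series `tan t`, `tan (t / 2)` and `t / sin t - 1`, whose coefficients are
compared by the double-angle formulas.
-/

namespace ThreeStrip

open MeasureTheory

section LinearExtensions

variable {P Q L Ω : Type*}

/-- The number of linear extensions of the relation `r` on `P`, counted as the bijections onto a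
fixed linear order `L` (of the same cardinality as `P`) that are increasing along `r`. -/
noncomputable def numLinearExtensions (L : Type*) [LT L] (r : P → P → Prop) : ℕ :=
  Nat.card {T : P ≃ L // ∀ a b, r a b → T a < T b}

theorem numLinearExtensions_congr [LT L] {r : P → P → Prop} {s : Q → Q → Prop} (e : r ≃r s) :
    numLinearExtensions L r = numLinearExtensions L s := by
  refine Nat.card_congr ((e.toEquiv.equivCongr (Equiv.refl L)).subtypeEquiv fun T => ?_)
  refine e.toEquiv.forall_congr fun a => e.toEquiv.forall_congr fun b =>
    imp_congr e.map_rel_iff.symm ?_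
  simp only [Equiv.equivCongr_apply_apply, Equiv.symm_apply_apply, Equiv.refl_apply]

/-- The order polytope of the relation `r` on `P`, with coordinates in `Ω` and with its boundary
removed. -/
def orderPolytope (Ω : Type*) [LT Ω] (r : P → P → Prop) : Set (P → Ω) :=
  {x | ∀ a b, r a b → x a < x b}

/-- The points of `Ω ^ P` whose coordinates are in the same order as the labels given by `T`: the
order polytope of the linear order that `T` induces on `P`. -/
def orderChamber (Ω : Type*) [LT L] [LT Ω] (T : P ≃ L) : Set (P → Ω) :=
  orderPolytope Ω fun a b => T a < T b

theorem lt_iff_lt_of_mem_orderChamber [LinearOrder L] [Preorder Ω] {T : P ≃ L} {x : P → Ω}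
    (hx : x ∈ orderChamber Ω T) {a b : P} : x a < x b ↔ T a < T b := by
  have hmono : StrictMono (x ∘ T.symm) := fun u v huv => hx _ _ (by simpa using huv)
  simpa using hmono.lt_iff_lt (a := T a) (b := T b)

theorem disjoint_orderChamber [LinearOrder L] [Finite L] [Preorder Ω] {T T' : P ≃ L}
    (h : T ≠ T') : Disjoint (orderChamber Ω T) (orderChamber Ω T') := by
  refine Set.disjoint_left.2 fun x hx hx' => h ?_
  have hmono : StrictMono (T.symm.trans T') := fun u v huv =>
    (lt_iff_lt_of_mem_orderChamber hx').1 (hx _ _ (by simpa using huv))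
  let e : L ≃o L := hmono.orderIsoOfSurjective _ (Equiv.surjective _)
  have he : e = OrderIso.refl L := Subsingleton.elim _ _
  ext a
  simpa [e] using (congr($he (T a))).symm

theorem exists_mem_orderChamber [Fintype P] [Fintype L] [LinearOrder L] [LinearOrder Ω]
    (hcard : Fintype.card P = Fintype.card L) {x : P → Ω} (hx : Function.Injective x) :
    ∃ T : P ≃ L, x ∈ orderChamber Ω T := by
  let _ : LinearOrder P := LinearOrder.lift' x hx
  let T : P ≃o L := (monoEquivOfFin P rfl).symm.trans (monoEquivOfFin L hcard.symm)
  exact ⟨T.toEquiv, fun a b => (T.lt_iff_lt (x := a) (y := b)).1⟩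

theorem measurableSet_orderPolytope [Countable P] [LinearOrder Ω] [TopologicalSpace Ω]
    [OrderClosedTopology Ω] [SecondCountableTopology Ω] [MeasurableSpace Ω]
    [OpensMeasurableSpace Ω] (r : P → P → Prop) : MeasurableSet (orderPolytope Ω r) := by
  simp only [orderPolytope, Set.ofPred_forall]
  exact .iInter fun a => .iInter fun b => .iInter fun _ =>
    measurableSet_lt (measurable_pi_apply a) (measurable_pi_apply b)

variable [Fintype P] [MeasurableSpace Ω] (μ : Measure Ω) [IsProbabilityMeasure μ]

theorem measure_pi_setOf_eq [MeasurableEq Ω] [NullSingletonClass μ] {a b : P} (h : a ≠ b) :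
    Measure.pi (fun _ => μ) {x : P → Ω | x a = x b} = 0 := by
  classical
  have hindep : ProbabilityTheory.iIndepFun (fun (i : P) (x : P → Ω) => x i)
      (Measure.pi fun _ => μ) :=
    ProbabilityTheory.iIndepFun_pi (X := fun _ => id) fun _ => aemeasurable_id
  have hmap : Measure.map (fun x : P → Ω => (x a, x b)) (Measure.pi fun _ => μ) = μ.prod μ := by
    rw [(ProbabilityTheory.indepFun_iff_map_prod_eq_prod_map_map
      (measurable_pi_apply a).aemeasurable (measurable_pi_apply b).aemeasurable).1
        (hindep.indepFun h)]
    exact congrArg₂ _ (measurePreserving_eval (fun _ : P => μ) a).map_eq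
      (measurePreserving_eval (fun _ : P => μ) b).map_eq
  have hdiag : μ.prod μ (Set.diagonal Ω) = 0 := by
    rw [Measure.measure_prod_null measurableSet_diagonal]
    refine Filter.Eventually.of_forall fun x => ?_
    have hslice : Prod.mk x ⁻¹' Set.diagonal Ω = {x} := by
      ext
      simp [eq_comm]
    exact (congrArg μ hslice).trans (measure_singleton x)
  rwa [← hmap, Measure.map_apply (by fun_prop) measurableSet_diagonal] at hdiag

theorem ae_injective_pi [MeasurableEq Ω] [NullSingletonClass μ] :
    ∀ᵐ x ∂Measure.pi fun _ : P => μ, Function.Injective x := by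
  have hne : ∀ a b : P, ∀ᵐ x ∂Measure.pi fun _ : P => μ, x a = x b → a = b := fun a b => by
    by_cases h : a = b
    · simp [h]
    · simpa [ae_iff, h] using measure_pi_setOf_eq μ h
  filter_upwards [ae_all_iff.2 fun a => ae_all_iff.2 (hne a)] with x hx a b
  exact hx a b

variable [LinearOrder L] [LinearOrder Ω] [TopologicalSpace Ω] [OrderClosedTopology Ω]
  [SecondCountableTopology Ω] [OpensMeasurableSpace Ω]

theorem measure_orderChamber_eq (T T' : P ≃ L) :
    Measure.pi (fun _ => μ) (orderChamber Ω T) = Measure.pi (fun _ => μ) (orderChamber Ω T') := by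
  have hperm := measurePreserving_piCongrLeft (fun _ : P => μ) (T'.trans T.symm)
  refine (hperm.measure_preimage (measurableSet_orderPolytope _).nullMeasurableSet).symm.trans ?_
  congr 1
  ext x
  refine ((T'.trans T.symm).forall_congr fun a => (T'.trans T.symm).forall_congr fun b => ?_).symm
  rw [MeasurableEquiv.coe_piCongrLeft, Equiv.piCongrLeft_apply_apply,
    Equiv.piCongrLeft_apply_apply]
  simp

variable [NullSingletonClass μ] [Fintype L]

theorem orderPolytope_ae_eq_iUnion_orderChamber (hcard : Fintype.card P = Fintype.card L)
    (r : P → P → Prop) :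
    orderPolytope Ω r =ᵐ[Measure.pi fun _ => μ]
      ⋃ T : {T : P ≃ L // ∀ a b, r a b → T a < T b}, orderChamber Ω T.1 := by
  filter_upwards [ae_injective_pi μ] with x hx
  obtain ⟨T, hT⟩ := exists_mem_orderChamber hcard hx
  refine propext ⟨fun h => Set.mem_iUnion.2 ⟨⟨T, fun a b hab => ?_⟩, hT⟩, fun h a b hab => ?_⟩
  · exact (lt_iff_lt_of_mem_orderChamber hT).1 (h a b hab)
  · obtain ⟨T', hT'⟩ := Set.mem_iUnion.1 h
    exact hT' a b (T'.2 a b hab)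

theorem measure_orderPolytope_eq_mul (hcard : Fintype.card P = Fintype.card L)
    (r : P → P → Prop) (T₀ : P ≃ L) :
    Measure.pi (fun _ => μ) (orderPolytope Ω r) =
      numLinearExtensions L r * Measure.pi (fun _ => μ) (orderChamber Ω T₀) := by
  rw [measure_congr (orderPolytope_ae_eq_iUnion_orderChamber μ hcard r),
    measure_iUnion (fun T T' h => disjoint_orderChamber (Subtype.coe_ne_coe.2 h))
      fun _ => measurableSet_orderPolytope _,
    tsum_congr fun T : {T : P ≃ L // ∀ a b, r a b → T a < T b} =>
      measure_orderChamber_eq μ T.1 T₀, ENNReal.tsum_const,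
    ENat.card_eq_coe_natCard, numLinearExtensions, ENat.toENNReal_coe]

theorem numLinearExtensions_eq_factorial_mul (hcard : Fintype.card P = Fintype.card L)
    (r : P → P → Prop) :
    (numLinearExtensions L r : ℝ) =
      (Fintype.card P).factorial * (Measure.pi fun _ => μ).real (orderPolytope Ω r) := by
  classical
  let T₀ : P ≃ L := Fintype.equivOfCardEq hcard
  have htop := measure_orderPolytope_eq_mul μ hcard (fun _ _ => False) T₀
  have hcount : numLinearExtensions L (fun _ _ : P => False) = (Fintype.card P).factorial := by
    rw [← Fintype.card_equiv T₀, numLinearExtensions, Nat.card_eq_fintype_card]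
    exact Fintype.card_congr (Equiv.subtypeUnivEquiv fun T => by simp)
  simp only [orderPolytope, false_imp_iff, implies_true, Set.ofPred_true, measure_univ,
    hcount] at htop
  rw [measureReal_def, ← ENNReal.toReal_natCast (Nat.factorial _), ← ENNReal.toReal_mul,
    measure_orderPolytope_eq_mul μ hcard r T₀, mul_left_comm, ← htop, mul_one,
    ENNReal.toReal_natCast]

end LinearExtensions

section SkewShapes

theorem mem_skewCells {lam mu : YoungDiagram} {p : ℕ × ℕ} :
    p ∈ skewCells lam mu ↔ p ∈ lam ∧ p ∉ mu := by
  simp [skewCells]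

theorem ordConnected_skewCells (lam mu : YoungDiagram) :
    (skewCells lam mu : Set (ℕ × ℕ)).OrdConnected := by
  refine ⟨fun p hp q hq x hx => ?_⟩
  rw [Finset.mem_coe, mem_skewCells] at *
  exact ⟨lam.isLowerSet hx.2 hq.1, fun hxmu => hp.2 (mu.isLowerSet hx.1 hxmu)⟩

theorem isStandard_iff_forall_covBy {D : Finset (ℕ × ℕ)} (hD : (D : Set (ℕ × ℕ)).OrdConnected)
    (T : D ≃ Finset.Icc 1 D.card) :
    IsStandard D T ↔ ∀ a b : D, a.1 ⋖ b.1 → T a < T b := by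
  refine ⟨fun ⟨hrow, hcol⟩ a b hab => ?_, fun h => ?_⟩
  · rcases Prod.covBy_iff.1 hab with ⟨hlt, heq⟩ | ⟨hlt, heq⟩
    · exact hcol a b heq hlt.lt
    · exact hrow a b heq hlt.lt
  · classical
    let _ : LocallyFiniteOrder D := Fintype.toLocallyFiniteOrder
    have hmono : StrictMono T := (strictMono_iff_forall_covBy T).2 fun a b hab =>
      h a b (hab.image (OrderEmbedding.subtype (· ∈ D)) (by simpa using hD))
    exact ⟨fun a b heq hlt => hmono (Prod.lt_iff.2 (.inr ⟨heq.le, hlt⟩)),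
      fun a b heq hlt => hmono (Prod.lt_iff.2 (.inl ⟨hlt, heq.le⟩))⟩

theorem numSYT_eq_numLinearExtensions (lam mu : YoungDiagram) :
    numSYT lam mu = numLinearExtensions (Finset.Icc 1 (skewCells lam mu).card)
      fun a b : skewCells lam mu => a.1 ⋖ b.1 :=
  Nat.card_congr (Equiv.subtypeEquivRight fun T =>
    isStandard_iff_forall_covBy (ordConnected_skewCells lam mu) T)

theorem getElem_down {a b t : ℕ} (h : t < (down a b).length) : (down a b)[t] = a - t := by
  simp only [down, List.length_reverse, List.length_range'] at h
  simp only [down, List.getElem_reverse, List.length_range', List.getElem_range']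
  omega

theorem length_down (a b : ℕ) : (down a b).length = a + 1 - b := by simp [down]

theorem mem_outerShape {k n b i j : ℕ} : (i, j) ∈ outerShape k n b ↔
    i < k + (n + 1 - b) ∧ j < n - (i - k) := by
  rw [outerShape, YoungDiagram.mem_ofRowLens]
  simp only [List.getElem_append, List.length_append, List.length_replicate, length_down,
    List.getElem_replicate, getElem_down, exists_prop]
  refine and_congr_right fun _ => ?_
  split_ifs with h
  · rw [Nat.sub_eq_zero_of_le h.le, Nat.sub_zero]
  · rfl

theorem mem_innerShape {a k i j : ℕ} : (i, j) ∈ innerShape a k ↔ i + j < a := by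
  rw [innerShape, YoungDiagram.mem_ofRowLens]
  simp only [List.getElem_append, List.length_append, List.length_replicate, length_down,
    List.getElem_replicate, getElem_down, exists_prop]
  split_ifs with h <;> omega

end SkewShapes

section Strips

open unitInterval

variable {M D U Ω : Type*}

/-- The relation on `M ⊕ D ⊕ U` that puts `d : D` below `i : M` when `lo d i`, and `i : M` below
`u : U` when `hi i u`. -/
def layered (lo : D → M → Prop) (hi : M → U → Prop) : M ⊕ D ⊕ U → M ⊕ D ⊕ U → Prop
  | .inr (.inl d), .inl i => lo d i
  | .inl i, .inr (.inr u) => hi i u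
  | _, _ => False

theorem measure_orderPolytope_layered [Fintype M] [Fintype D] [Fintype U] [LinearOrder Ω]
    [TopologicalSpace Ω] [OrderClosedTopology Ω] [SecondCountableTopology Ω] [MeasurableSpace Ω]
    [OpensMeasurableSpace Ω] (μ : Measure Ω) [SigmaFinite μ] (lo : D → M → Prop)
    (hi : M → U → Prop) :
    Measure.pi (fun _ => μ) (orderPolytope Ω (layered lo hi)) =
      ∫⁻ b : M → Ω, (∏ d, μ {y | ∀ i, lo d i → y < b i}) * ∏ u, μ {y | ∀ i, hi i u → b i < y}
        ∂Measure.pi fun _ => μ := by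
  have hsplit := measurePreserving_sumPiEquivProdPi_symm fun _ : M ⊕ D ⊕ U => μ
  have hmeas := measurableSet_orderPolytope (Ω := Ω) (layered lo hi)
  rw [← hsplit.measure_preimage hmeas.nullMeasurableSet,
    Measure.prod_apply (hsplit.measurable hmeas)]
  refine lintegral_congr fun b => ?_
  have hbox := Measure.pi_pi (fun _ : D ⊕ U => μ)
    (Sum.elim (fun d => {y | ∀ i, lo d i → y < b i}) fun u => {y | ∀ i, hi i u → b i < y})
  rw [Fintype.prod_sum_type] at hbox
  refine (congrArg _ ?_).trans hbox
  ext y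
  simp only [orderPolytope, layered, Set.mem_preimage, Set.mem_ofPred_eq, Set.mem_pi, Set.mem_univ,
    forall_true_left, Sum.forall, false_imp_iff, implies_true, true_and, and_true, Sum.elim_inl,
    Sum.elim_inr]
  exact ⟨fun h => ⟨h.2, fun u i hiu => h.1 i u hiu⟩, fun h => ⟨fun i u hiu => h.2 u i hiu, h.1⟩⟩

/-- The strip poset with middle elements `0, …, m`, lower elements `A` and upper elements `C`: the
`k`-th lower element lies below, and the `k`-th upper element above, the middle elements `k - 1`
and `k` (those of the two that exist). -/
def strip (m : ℕ) (A C : Finset ℕ) : Fin (m + 1) ⊕ A ⊕ C → Fin (m + 1) ⊕ A ⊕ C → Prop :=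
  layered (fun k i => k.1 = i ∨ k.1 = i + 1) fun i k => k.1 = i ∨ k.1 = i + 1

variable {m : ℕ} {A C : Finset ℕ}

/-- The box occupied by an element of a strip poset: the middle elements go, from the top right to
the bottom left, to the boxes `(s, m), (s + 1, m - 1), …, (s + m, 0)`. -/
def stripCell (m s : ℕ) : Fin (m + 1) ⊕ A ⊕ C → ℕ × ℕ
  | .inl i => (i + s, m - i)
  | .inr (.inl k) => (k + s - 1, m - k)
  | .inr (.inr k) => (k + s, m + 1 - k)

theorem stripCell_covBy_stripCell_iff {s : ℕ} (hA : ∀ k ∈ A, k ≤ m ∧ 1 ≤ k + s)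
    (hC : ∀ k ∈ C, k ≤ m + 1) (a b : Fin (m + 1) ⊕ A ⊕ C) :
    stripCell m s a ⋖ stripCell m s b ↔ strip m A C a b := by
  rcases a with i | ⟨k, hk⟩ | ⟨k, hk⟩ <;> rcases b with j | ⟨l, hl⟩ | ⟨l, hl⟩ <;>
    simp only [stripCell, strip, layered, Prod.mk_covBy_mk_iff, Nat.covBy_iff_add_one_eq] <;>
    grind

theorem numSYT_eq_factorial_mul_volume_strip {lam mu : YoungDiagram} {N : ℕ} (s : ℕ)
    (hN : m + 1 + (A.card + C.card) = N) (hA : ∀ k ∈ A, k ≤ m ∧ 1 ≤ k + s)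
    (hC : ∀ k ∈ C, k ≤ m + 1)
    (hcells : ∀ i j, (i, j) ∈ skewCells lam mu ↔ (i + j = m + s ∧ s ≤ i) ∨
      (i + j + 1 = m + s ∧ s ≤ i + 1 ∧ i + 1 - s ∈ A) ∨
      (i + j = m + s + 1 ∧ s ≤ i ∧ i - s ∈ C)) :
    (numSYT lam mu : ℝ) = N.factorial * volume.real (orderPolytope I (strip m A C)) := by
  have hmem (a : Fin (m + 1) ⊕ A ⊕ C) : stripCell m s a ∈ skewCells lam mu := by
    rcases a with i | ⟨k, hk⟩ | ⟨k, hk⟩ <;> simp only [stripCell, hcells] <;> grind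
  have hinj : Function.Injective (stripCell m s : Fin (m + 1) ⊕ A ⊕ C → ℕ × ℕ) := by
    rintro (i | ⟨k, hk⟩ | ⟨k, hk⟩) (j | ⟨l, hl⟩ | ⟨l, hl⟩) <;>
      simp only [stripCell, Prod.mk.injEq] <;> grind
  have hsurj : ∀ p ∈ skewCells lam mu, ∃ a : Fin (m + 1) ⊕ A ⊕ C, stripCell m s a = p := by
    rintro ⟨i, j⟩ hp
    rcases (hcells i j).1 hp with ⟨h, hs⟩ | ⟨h, hs, hk⟩ | ⟨h, hs, hk⟩
    · exact ⟨.inl ⟨i - s, by omega⟩, by grind [stripCell]⟩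
    · exact ⟨.inr (.inl ⟨_, hk⟩), by grind [stripCell]⟩
    · exact ⟨.inr (.inr ⟨_, hk⟩), by grind [stripCell]⟩
  let e : Fin (m + 1) ⊕ A ⊕ C ≃ skewCells lam mu :=
    Equiv.ofBijective (fun a => ⟨stripCell m s a, hmem a⟩)
      ⟨fun a b h => hinj (congrArg Subtype.val h),
        fun p => (hsurj p.1 p.2).imp fun _ => Subtype.ext⟩
  have hcard := Fintype.card_congr e
  simp only [Fintype.card_sum, Fintype.card_fin, Fintype.card_coe] at hcard
  rw [numSYT_eq_numLinearExtensions, ← numLinearExtensions_congr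
    (⟨e, fun {a b} => stripCell_covBy_stripCell_iff hA hC a b⟩ : strip m A C ≃r _),
    numLinearExtensions_eq_factorial_mul (volume : Measure I) (by simpa using hcard)]
  simp [volume_pi, hN]

theorem fSigma2_succ_eq_volume (m : ℕ) :
    (fSigma2 (m + 1) : ℝ) = (3 * m + 1).factorial *
      volume.real (orderPolytope I (strip m (.Ico 1 (m + 1)) (.Ico 1 (m + 1)))) := by
  rw [fSigma2]
  refine numSYT_eq_factorial_mul_volume_strip 0 (by simp only [Nat.card_Ico]; lia) (by grind)
    (by grind) fun i j => ?_
  rw [mem_skewCells, mem_outerShape, mem_innerShape]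
  grind

theorem fSigma1_succ_eq_volume (m : ℕ) :
    (fSigma1 (m + 1) : ℝ) = (3 * m + 2).factorial *
      volume.real (orderPolytope I (strip m (.range (m + 1)) (.Ico 1 (m + 1)))) := by
  rw [fSigma1]
  refine numSYT_eq_factorial_mul_volume_strip 1
    (by simp only [Finset.card_range, Nat.card_Ico]; lia) (by grind) (by grind) fun i j => ?_
  rw [mem_skewCells, mem_outerShape, mem_innerShape]
  grind

theorem fSigma0_succ_eq_volume (m : ℕ) :
    (fSigma0 (m + 1) : ℝ) = (3 * m + 3).factorial *
      volume.real (orderPolytope I (strip m (.range (m + 1)) (.Ico 1 (m + 2)))) := by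
  rw [fSigma0]
  refine numSYT_eq_factorial_mul_volume_strip 1
    (by simp only [Finset.card_range, Nat.card_Ico]; lia) (by grind) (by grind) fun i j => ?_
  rw [mem_skewCells, mem_outerShape, mem_innerShape]
  grind

theorem isUpDown_iff {n : ℕ} (w : Equiv.Perm (Fin n)) : IsUpDown w ↔
    ∀ a b : Fin n, Even a.1 ∧ (a.1 + 1 = b ∨ b.1 + 1 = a) → w a < w b := by
  refine ⟨?_, fun h i hi =>
    ⟨fun he => h _ _ ⟨he, .inl rfl⟩, fun ho => h _ _ ⟨ho.add_one, .inr rfl⟩⟩⟩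
  rintro h ⟨a, ha⟩ ⟨b, hb⟩ ⟨heven, rfl | rfl⟩
  · exact (h a hb).1 heven
  · exact (h b ha).2 (Nat.not_even_iff_odd.1 (Nat.even_add_one.1 heven))

theorem eulerNumber_two_mul_add_one_eq_volume (m : ℕ) :
    (eulerNumber (2 * m + 1) : ℝ) = (2 * m + 1).factorial *
      volume.real (orderPolytope I (strip m ∅ (.Ico 1 (m + 1)))) := by
  let pos : Fin (m + 1) ⊕ (∅ : Finset ℕ) ⊕ Finset.Ico 1 (m + 1) → Fin (2 * m + 1)
    | .inl i => ⟨2 * i, by omega⟩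
    | .inr (.inr k) => ⟨2 * k - 1, by grind⟩
  have hinj : Function.Injective pos := by
    rintro (i | ⟨k, hk⟩ | ⟨k, hk⟩) (j | ⟨l, hl⟩ | ⟨l, hl⟩) <;> grind
  have hbij : Function.Bijective pos := by
    rw [Fintype.bijective_iff_injective_and_card]
    refine ⟨hinj, ?_⟩
    simp only [Fintype.card_sum, Fintype.card_fin, Fintype.card_eq_zero, Fintype.card_coe,
      Nat.card_Ico]
    lia
  let e : strip m ∅ (.Ico 1 (m + 1)) ≃r
      fun a b : Fin (2 * m + 1) => Even a.1 ∧ (a.1 + 1 = b ∨ b.1 + 1 = a) :=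
    ⟨Equiv.ofBijective pos hbij, by
      rintro (i | ⟨k, hk⟩ | ⟨k, hk⟩) (j | ⟨l, hl⟩ | ⟨l, hl⟩) <;>
        simp only [Equiv.ofBijective_apply, pos, strip, layered] <;> grind⟩
  have hcount : eulerNumber (2 * m + 1) =
      numLinearExtensions (Fin (2 * m + 1)) (strip m ∅ (.Ico 1 (m + 1))) := by
    rw [numLinearExtensions_congr e]
    exact Nat.card_congr (Equiv.subtypeEquivRight isUpDown_iff)
  have hcard := Fintype.card_of_bijective hbij
  rw [hcount, numLinearExtensions_eq_factorial_mul (volume : Measure I) hcard, hcard,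
    Fintype.card_fin, volume_pi]

end Strips

section ChainIntegrals

variable {α : Type*} [MeasurableSpace α] (μ : Measure α) [SigmaFinite μ]

theorem lintegral_pi_fin_succ {n : ℕ} {f : α × (Fin n → α) → ENNReal} (hf : Measurable f) :
    ∫⁻ x : Fin (n + 1) → α, f (x 0, Fin.tail x) ∂Measure.pi (fun _ => μ) =
      ∫⁻ y, ∫⁻ x, f (x, y) ∂μ ∂Measure.pi (fun _ => μ) := by
  rw [← lintegral_prod_symm' _ hf]
  exact (measurePreserving_piFinSuccAbove (fun _ : Fin (n + 1) => μ) 0).lintegral_comp hf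

theorem lintegral_pi_chain {k : α → α → ENNReal} (hk : Measurable (Function.uncurry k))
    {q : ℕ → α → ENNReal} (hq₀ : Measurable (q 0))
    (hq : ∀ n y, ∫⁻ x, q n x * k x y ∂μ = q (n + 1) y) {h : α → ENNReal} (hh : Measurable h)
    (m : ℕ) :
    ∫⁻ x : Fin (m + 1) → α,
        q 0 (x 0) * (∏ i : Fin m, k (x i.castSucc) (x i.succ)) * h (x (Fin.last m))
        ∂Measure.pi (fun _ => μ) = ∫⁻ y, q m y * h y ∂μ := by
  induction m generalizing q with
  | zero =>
    refine Eq.trans ?_ ((measurePreserving_funUnique μ (Fin 1)).lintegral_comp (hq₀.mul hh))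
    simp only [Finset.univ_eq_empty, Finset.prod_empty, mul_one, Fin.last_zero,
      MeasurableEquiv.funUnique_apply, Fin.default_eq_zero]
    congr!
  | succ m ih =>
    have hk_comp {β : Type _} [MeasurableSpace β] {f g : β → α} (hf : Measurable f)
        (hg : Measurable g) : Measurable fun b => k (f b) (g b) := hk.comp (hf.prodMk hg)
    have hq₁ : Measurable (q 1) := by
      rw [← funext (hq 0)]
      exact Measurable.lintegral_prod_left' (f := fun p : α × α => q 0 p.1 * k p.1 p.2)
        ((hq₀.comp measurable_fst).mul (hk_comp measurable_fst measurable_snd))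
    let rest : (Fin (m + 1) → α) → ENNReal := fun y =>
      (∏ i : Fin m, k (y i.castSucc) (y i.succ)) * h (y (Fin.last m))
    have hrest : Measurable rest :=
      (Finset.measurable_prod _ fun i _ => hk_comp (by fun_prop) (by fun_prop)).mul
        (hh.comp (by fun_prop))
    let f : α × (Fin (m + 1) → α) → ENNReal := fun p => q 0 p.1 * k p.1 (p.2 0) * rest p.2
    have hf : Measurable f :=
      ((hq₀.comp measurable_fst).mul (hk_comp (by fun_prop) (by fun_prop))).mul
        (hrest.comp measurable_snd)
    calc
      _ = ∫⁻ x : Fin (m + 2) → α, f (x 0, Fin.tail x) ∂Measure.pi (fun _ => μ) := by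
        simp only [f, rest, Fin.prod_univ_succ, mul_assoc]
        rfl
      _ = ∫⁻ y, q 1 (y 0) * rest y ∂Measure.pi (fun _ => μ) := by
        rw [lintegral_pi_fin_succ μ hf]
        exact lintegral_congr fun y => (lintegral_mul_const (rest y)
          (hq₀.mul (hk_comp measurable_id measurable_const))).trans congr($(hq 0 (y 0)) * rest y)
      _ = _ := by
        simp only [rest, ← mul_assoc]
        exact ih (q := fun n => q (n + 1)) hq₁ fun n => hq (n + 1)

open unitInterval

theorem lintegral_unitInterval_ofReal {f : ℝ → ℝ} (hf : Continuous f) (hf₀ : ∀ x : I, 0 ≤ f x) :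
    ∫⁻ x : I, ENNReal.ofReal (f x) = ENNReal.ofReal (∫ x in (0 : ℝ)..1, f x) := by
  have hint : Integrable fun x : I => f x :=
    (hf.comp continuous_subtype_val).integrable_of_hasCompactSupport (.of_compactSpace _)
  rw [← ofReal_integral_eq_lintegral_ofReal hint (.of_forall hf₀),
    intervalIntegral.integral_of_le zero_le_one, ← integral_Icc_eq_integral_Ioc,
    ← integral_subtype_comap measurableSet_Icc]
  rfl

/-- A sequence of continuous functions on `[0, 1]`, each obtained from the preceding one by
applying the integral operator with kernel `k`. -/
structure IsTransferOrbit (k : ℝ → ℝ → ℝ) (q : ℕ → ℝ → ℝ) : Prop where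
  continuous : ∀ n, Continuous (q n)
  integral_mul : ∀ n, ∀ y : I, ∫ x in (0 : ℝ)..1, q n x * k x y = q (n + 1) y

namespace IsTransferOrbit

variable {k : ℝ → ℝ → ℝ} {q q' : ℕ → ℝ → ℝ}

theorem nonneg (hq : IsTransferOrbit k q) (hk : ∀ x y : I, 0 ≤ k x y) (hq₀ : ∀ x : I, 0 ≤ q 0 x)
    (n : ℕ) (x : I) : 0 ≤ q n x := by
  induction n generalizing x with
  | zero => exact hq₀ x
  | succ n ih =>
    rw [← hq.integral_mul]
    exact intervalIntegral.integral_nonneg zero_le_one fun y hy => mul_nonneg (ih ⟨y, hy⟩)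
      (hk ⟨y, hy⟩ x)

theorem add (hq : IsTransferOrbit k q) (hq' : IsTransferOrbit k q')
    (hk : ∀ y, Continuous (k · y)) : IsTransferOrbit k (q + q') where
  continuous n := (hq.continuous n).add (hq'.continuous n)
  integral_mul n y := by
    have hint {f : ℝ → ℝ} (hf : Continuous f) :
        IntervalIntegrable (fun x => f x * k x y) volume 0 1 :=
      (hf.mul (hk y)).intervalIntegrable 0 1
    simp only [Pi.add_apply, add_mul]
    rw [intervalIntegral.integral_add (hint (hq.continuous n)) (hint (hq'.continuous n)),
      hq.integral_mul, hq'.integral_mul]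

theorem reflect (hq : IsTransferOrbit k q) (hk : ∀ x y, k (1 - x) (1 - y) = k x y) :
    IsTransferOrbit k fun n x => q n (1 - x) where
  continuous n := (hq.continuous n).comp (continuous_const.sub continuous_id)
  integral_mul n y := by
    have hflip := intervalIntegral.integral_comp_sub_left (a := 0) (b := 1)
      (fun x => q n x * k x (σ y)) 1
    simp only [unitInterval.coe_symm_eq, hk, sub_zero, sub_self] at hflip
    rw [hflip, ← unitInterval.coe_symm_eq, hq.integral_mul]

theorem toReal_lintegral_chain (hq : IsTransferOrbit k q) (hk : Continuous (Function.uncurry k))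
    (hk₀ : ∀ x y : I, 0 ≤ k x y) (hq₀ : ∀ x : I, 0 ≤ q 0 x) {h : ℝ → ℝ} (hh : Continuous h)
    (hh₀ : ∀ x : I, 0 ≤ h x) (m : ℕ) :
    (∫⁻ x : Fin (m + 1) → I, ENNReal.ofReal (q 0 (x 0)) *
        (∏ i : Fin m, ENNReal.ofReal (k (x i.castSucc) (x i.succ))) *
          ENNReal.ofReal (h (x (Fin.last m)))).toReal =
      ∫ x in (0 : ℝ)..1, q m x * h x := by
  have hq_nonneg := hq.nonneg hk₀ hq₀
  have hk_meas : Measurable (Function.uncurry fun x y : I => ENNReal.ofReal (k x y)) :=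
    (hk.comp (continuous_subtype_val.prodMap continuous_subtype_val)).measurable.ennreal_ofReal
  have hmeas {f : ℝ → ℝ} (hf : Continuous f) : Measurable fun x : I => ENNReal.ofReal (f x) :=
    (hf.comp continuous_subtype_val).measurable.ennreal_ofReal
  have hstep (n : ℕ) (y : I) : ∫⁻ x : I, ENNReal.ofReal (q n x) * ENNReal.ofReal (k x y) =
      ENNReal.ofReal (q (n + 1) y) := by
    simp_rw [← ENNReal.ofReal_mul (hq_nonneg n _)]
    rw [← hq.integral_mul]
    exact lintegral_unitInterval_ofReal ((hq.continuous n).mul (hk.uncurry_right (y : ℝ)))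
      fun x => mul_nonneg (hq_nonneg n x) (hk₀ x y)
  rw [volume_pi, lintegral_pi_chain volume hk_meas (q := fun n x => ENNReal.ofReal (q n x))
    (hmeas (hq.continuous 0)) hstep (hmeas hh)]
  have hqh₀ (x : I) : 0 ≤ q m x * h x := mul_nonneg (hq_nonneg m x) (hh₀ x)
  simp_rw [← ENNReal.ofReal_mul (hq_nonneg m _)]
  rw [lintegral_unitInterval_ofReal (f := fun x => q m x * h x) ((hq.continuous m).mul hh) hqh₀,
    ENNReal.toReal_ofReal (intervalIntegral.integral_nonneg zero_le_one fun x hx => hqh₀ ⟨x, hx⟩)]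

end IsTransferOrbit

end ChainIntegrals

section StripVolumes

open unitInterval

/-- The kernel of an upper element between two consecutive middle elements `x` and `y`: the length
of the interval that it ranges over. -/
noncomputable def peakKernel (x y : ℝ) : ℝ := 1 - max x y

/-- The kernel of a lower and an upper element between two consecutive middle elements `x` and `y`:
the area of the rectangle that they range over. -/
noncomputable def stripKernel (x y : ℝ) : ℝ := min x y * (1 - max x y)

theorem continuous_peakKernel : Continuous (Function.uncurry peakKernel) := by
  unfold peakKernel Function.uncurry
  fun_prop

theorem continuous_stripKernel : Continuous (Function.uncurry stripKernel) := by
  unfold stripKernel Function.uncurry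
  fun_prop

theorem peakKernel_nonneg (x y : I) : 0 ≤ peakKernel x y :=
  sub_nonneg.2 (max_le x.2.2 y.2.2)

theorem stripKernel_nonneg (x y : I) : 0 ≤ stripKernel x y :=
  mul_nonneg (le_min x.2.1 y.2.1) (peakKernel_nonneg x y)

theorem stripKernel_one_sub_one_sub (x y : ℝ) : stripKernel (1 - x) (1 - y) = stripKernel x y := by
  simp only [stripKernel, min_sub_sub_left, max_sub_sub_left]
  ring

variable {m : ℕ} (b : Fin (m + 1) → I)

/-- The length of the interval that the `k`-th lower element of a strip ranges over, once the
coordinates `b` of the middle elements are fixed. -/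
noncomputable def lowerWeight (k : ℕ) : ENNReal :=
  volume {y : I | ∀ i : Fin (m + 1), k = i ∨ k = i + 1 → y < b i}

/-- The length of the interval that the `k`-th upper element of a strip ranges over, once the
coordinates `b` of the middle elements are fixed. -/
noncomputable def upperWeight (k : ℕ) : ENNReal :=
  volume {y : I | ∀ i : Fin (m + 1), k = i ∨ k = i + 1 → b i < y}

theorem volume_orderPolytope_strip (A C : Finset ℕ) :
    volume (orderPolytope I (strip m A C)) =
      ∫⁻ b : Fin (m + 1) → I, (∏ k ∈ A, lowerWeight b k) * ∏ k ∈ C, upperWeight b k := by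
  rw [volume_pi, strip, measure_orderPolytope_layered, volume_pi]
  refine lintegral_congr fun b => ?_
  rw [← Finset.prod_coe_sort A, ← Finset.prod_coe_sort C]
  rfl

theorem forall_fin_eq_or_eq_succ_iff {p : Fin (m + 1) → Prop} (j : Fin m) :
    (∀ i : Fin (m + 1), j.1 + 1 = i ∨ j.1 + 1 = i + 1 → p i) ↔ p j.castSucc ∧ p j.succ := by
  refine ⟨fun h => ⟨h _ (.inr rfl), h _ (.inl rfl)⟩, ?_⟩
  rintro ⟨hcast, hsucc⟩ i (hi | hi)
  · rwa [show i = j.succ from Fin.ext hi.symm]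
  · rwa [show i = j.castSucc from Fin.ext (Nat.succ_injective hi.symm)]

theorem lowerWeight_zero : lowerWeight b 0 = ENNReal.ofReal (b 0) := by
  refine (congrArg volume ?_).trans (unitInterval.volume_Iio (b 0))
  ext y
  simp [eq_comm]

theorem lowerWeight_succ (j : Fin m) :
    lowerWeight b (j + 1) = ENNReal.ofReal (min (b j.castSucc : ℝ) (b j.succ)) := by
  simp only [lowerWeight, forall_fin_eq_or_eq_succ_iff, ← lt_min_iff]
  exact unitInterval.volume_Iio _

theorem upperWeight_succ (j : Fin m) :
    upperWeight b (j + 1) = ENNReal.ofReal (peakKernel (b j.castSucc) (b j.succ)) := by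
  simp only [upperWeight, forall_fin_eq_or_eq_succ_iff, ← max_lt_iff]
  exact unitInterval.volume_Ioi _

theorem upperWeight_last : upperWeight b (m + 1) = ENNReal.ofReal (1 - b (Fin.last m)) := by
  refine (congrArg volume ?_).trans (unitInterval.volume_Ioi (b (Fin.last m)))
  ext y
  refine ⟨fun h => h _ (.inr rfl), fun h i hi => ?_⟩
  rwa [show i = Fin.last m from Fin.ext (by grind)]

theorem prod_lowerWeight_mul_upperWeight :
    (∏ j : Fin m, lowerWeight b (j + 1)) * ∏ j : Fin m, upperWeight b (j + 1) =
      ∏ j : Fin m, ENNReal.ofReal (stripKernel (b j.castSucc) (b j.succ)) := by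
  rw [← Finset.prod_mul_distrib]
  refine Finset.prod_congr rfl fun j _ => ?_
  rw [lowerWeight_succ, upperWeight_succ, ← ENNReal.ofReal_mul (le_min (b _).2.1 (b _).2.1)]
  rfl

theorem prod_Ico_one_succ (f : ℕ → ENNReal) :
    ∏ k ∈ Finset.Ico 1 (m + 1), f k = ∏ j : Fin m, f (j + 1) := by
  rw [Finset.prod_Ico_eq_prod_range, Finset.prod_range]
  simp [add_comm]

theorem prod_range_succ_eq (f : ℕ → ENNReal) :
    ∏ k ∈ Finset.range (m + 1), f k = f 0 * ∏ j : Fin m, f (j + 1) := by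
  rw [Finset.prod_range_succ', Finset.prod_range, mul_comm]

theorem eulerNumber_two_mul_add_one_eq_integral {q : ℕ → ℝ → ℝ}
    (hq : IsTransferOrbit peakKernel q) (hq₀ : ∀ x : I, q 0 x = 1) (m : ℕ) :
    (eulerNumber (2 * m + 1) : ℝ) = (2 * m + 1).factorial * ∫ x in (0 : ℝ)..1, q m x := by
  have hchain := hq.toReal_lintegral_chain continuous_peakKernel peakKernel_nonneg
    (fun x => by simp [hq₀]) (h := fun _ => 1) continuous_const (fun _ => zero_le_one) m
  simp only [mul_one] at hchain
  rw [eulerNumber_two_mul_add_one_eq_volume, measureReal_def, volume_orderPolytope_strip,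
    ← hchain]
  simp only [hq₀, Finset.prod_empty, prod_Ico_one_succ, upperWeight_succ, ENNReal.ofReal_one,
    one_mul, mul_one]

theorem fSigma2_succ_eq_integral {q : ℕ → ℝ → ℝ} (hq : IsTransferOrbit stripKernel q)
    (hq₀ : ∀ x : I, q 0 x = 1) (m : ℕ) :
    (fSigma2 (m + 1) : ℝ) = (3 * m + 1).factorial * ∫ x in (0 : ℝ)..1, q m x := by
  have hchain := hq.toReal_lintegral_chain continuous_stripKernel stripKernel_nonneg
    (fun x => by simp [hq₀]) (h := fun _ => 1) continuous_const (fun _ => zero_le_one) m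
  simp only [mul_one] at hchain
  rw [fSigma2_succ_eq_volume, measureReal_def, volume_orderPolytope_strip, ← hchain]
  simp only [hq₀, prod_Ico_one_succ, prod_lowerWeight_mul_upperWeight, ENNReal.ofReal_one,
    one_mul, mul_one]

theorem fSigma1_succ_eq_integral {q : ℕ → ℝ → ℝ} (hq : IsTransferOrbit stripKernel q)
    (hq₀ : ∀ x : I, q 0 x = x) (m : ℕ) :
    (fSigma1 (m + 1) : ℝ) = (3 * m + 2).factorial * ∫ x in (0 : ℝ)..1, q m x := by
  have hchain := hq.toReal_lintegral_chain continuous_stripKernel stripKernel_nonneg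
    (fun x => by simp [hq₀, x.2.1]) (h := fun _ => 1) continuous_const (fun _ => zero_le_one) m
  simp only [mul_one] at hchain
  rw [fSigma1_succ_eq_volume, measureReal_def, volume_orderPolytope_strip, ← hchain]
  simp only [hq₀, prod_range_succ_eq, prod_Ico_one_succ, lowerWeight_zero, mul_assoc,
    prod_lowerWeight_mul_upperWeight, ENNReal.ofReal_one, mul_one]

theorem fSigma0_succ_eq_integral {q : ℕ → ℝ → ℝ} (hq : IsTransferOrbit stripKernel q)
    (hq₀ : ∀ x : I, q 0 x = x) (m : ℕ) :
    (fSigma0 (m + 1) : ℝ) = (3 * m + 3).factorial * ∫ x in (0 : ℝ)..1, q m x * (1 - x) := by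
  rw [fSigma0_succ_eq_volume, measureReal_def, volume_orderPolytope_strip,
    ← hq.toReal_lintegral_chain continuous_stripKernel stripKernel_nonneg
    (fun x => by simp [hq₀, x.2.1]) (h := fun x => 1 - x) (by fun_prop)
    (fun x => sub_nonneg.2 x.2.2) m]
  congr 3 with b
  rw [prod_range_succ_eq, Finset.prod_Ico_succ_top (by omega), prod_Ico_one_succ, lowerWeight_zero,
    upperWeight_last, hq₀, ← prod_lowerWeight_mul_upperWeight]
  ring

end StripVolumes

section Moments

open unitInterval

theorem integral_pow_mul_one_sub (n : ℕ) :
    ∫ x in (0 : ℝ)..1, x ^ n * (1 - x) = 1 / ((n + 1) * (n + 2)) := by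
  have hexpand (x : ℝ) : x ^ n * (1 - x) = x ^ n - x ^ (n + 1) := by ring
  simp_rw [hexpand]
  rw [intervalIntegral.integral_sub (Continuous.intervalIntegrable (by fun_prop) _ _)
    (Continuous.intervalIntegrable (by fun_prop) _ _), integral_pow, integral_pow]
  push_cast
  have : (n : ℝ) + 1 + 1 ≠ 0 := by positivity
  field_simp
  ring

theorem integral_pow_mul_peakKernel (n : ℕ) (y : I) :
    ∫ x in (0 : ℝ)..1, x ^ n * peakKernel x y = (1 - (y : ℝ) ^ (n + 2)) / ((n + 1) * (n + 2)) := by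
  obtain ⟨y, hy₀, hy₁⟩ := y
  have hint (a b : ℝ) : IntervalIntegrable (fun x => x ^ n * peakKernel x y) volume a b :=
    ((continuous_pow n).mul (continuous_peakKernel.uncurry_right y)).intervalIntegrable a b
  have hleft : ∫ x in (0 : ℝ)..y, x ^ n * peakKernel x y = ∫ x in (0 : ℝ)..y, x ^ n * (1 - y) := by
    refine intervalIntegral.integral_congr fun x hx => ?_
    rw [Set.uIcc_of_le hy₀] at hx
    simp only [peakKernel, max_eq_right hx.2]
  have hright : ∫ x in y..1, x ^ n * peakKernel x y = ∫ x in y..1, (x ^ n - x ^ (n + 1)) := by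
    refine intervalIntegral.integral_congr fun x hx => ?_
    rw [Set.uIcc_of_le hy₁] at hx
    simp only [peakKernel, max_eq_left hx.1]
    ring
  rw [← intervalIntegral.integral_add_adjacent_intervals (hint 0 y) (hint y 1), hleft, hright,
    intervalIntegral.integral_mul_const, intervalIntegral.integral_sub
      (Continuous.intervalIntegrable (by fun_prop) _ _)
      (Continuous.intervalIntegrable (by fun_prop) _ _)]
  simp only [integral_pow]
  push_cast
  have : (n : ℝ) + 1 + 1 ≠ 0 := by positivity
  field_simp
  ring

theorem stripKernel_eq_peakKernel_sub (x y : ℝ) :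
    stripKernel x y = peakKernel x y - (1 - x) * (1 - y) := by
  rw [stripKernel, peakKernel]
  linear_combination min_add_max x y - min_mul_max x y

theorem integral_pow_mul_stripKernel (n : ℕ) (y : I) :
    ∫ x in (0 : ℝ)..1, x ^ n * stripKernel x y =
      ((y : ℝ) - (y : ℝ) ^ (n + 2)) / ((n + 1) * (n + 2)) := by
  have hpeak : Continuous (peakKernel · y) := continuous_peakKernel.uncurry_right _
  simp_rw [stripKernel_eq_peakKernel_sub, mul_sub (_ ^ n), ← mul_assoc]
  rw [intervalIntegral.integral_sub (Continuous.intervalIntegrable (by fun_prop) _ _)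
    (Continuous.intervalIntegrable (by fun_prop) _ _), intervalIntegral.integral_mul_const,
    integral_pow_mul_peakKernel, integral_pow_mul_one_sub]
  ring

end Moments

section Stumpff

open Finset PowerSeries unitInterval

/-- The Stumpff series `c_a(z) = ∑ (-1) ^ j z ^ j / (2 j + a)!`, whose first members satisfy
`c_0(t ^ 2) = cos t` and `t c_1(t ^ 2) = sin t`. -/
noncomputable def stumpff (a : ℕ) : PowerSeries ℚ :=
  PowerSeries.mk fun j => (-1) ^ j / (2 * j + a).factorial

/-- The quotient `c_b / c_a` of two Stumpff series. -/
noncomputable def stumpffRatio (a b : ℕ) : PowerSeries ℚ := (stumpff a)⁻¹ * stumpff b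

theorem coeff_stumpff_succ_right (a j : ℕ) :
    coeff j (stumpff (a + 1)) = coeff j (stumpff a) / (2 * j + a + 1) := by
  have : ((2 * j + a).factorial : ℚ) ≠ 0 := by positivity
  simp only [stumpff, coeff_mk, ← add_assoc, Nat.factorial_succ]
  push_cast
  field_simp

theorem coeff_stumpff_add_two (a j : ℕ) :
    coeff j (stumpff (a + 2)) = coeff j (stumpff a) / ((2 * j + a + 1) * (2 * j + a + 2)) := by
  rw [coeff_stumpff_succ_right, coeff_stumpff_succ_right, div_div]
  push_cast
  ring

theorem coeff_succ_stumpff (a j : ℕ) :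
    coeff (j + 1) (stumpff a) = -coeff j (stumpff (a + 2)) := by
  rw [stumpff, stumpff, coeff_mk, coeff_mk, show 2 * (j + 1) + a = 2 * j + (a + 2) by ring]
  ring

theorem stumpffRatio_self (a : ℕ) : stumpffRatio a a = 1 := by
  refine PowerSeries.inv_mul_cancel _ ?_
  rw [← coeff_zero_eq_constantCoeff_apply, stumpff, coeff_mk]
  positivity

theorem stumpffRatio_mul_stumpff (a b : ℕ) : stumpffRatio a b * stumpff a = stumpff b := by
  rw [stumpffRatio, mul_right_comm, ← stumpffRatio, stumpffRatio_self, one_mul]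

/-- The coefficient of `t ^ (2 m)` in `x ^ a c_a(t ^ 2 x ^ 2) / c_a(t ^ 2)`, where `c_a` is a
Stumpff series; as a function of `x`, it is a polynomial. -/
noncomputable def stumpffOrbit (a m : ℕ) (x : ℝ) : ℝ :=
  ∑ p ∈ antidiagonal m,
    ((coeff p.1 (stumpff a)⁻¹ * coeff p.2 (stumpff a) : ℚ) : ℝ) * x ^ (2 * p.2 + a)

theorem continuous_stumpffOrbit (a m : ℕ) : Continuous (stumpffOrbit a m) := by
  unfold stumpffOrbit
  fun_prop

theorem stumpffOrbit_zero (a : ℕ) (x : ℝ) : stumpffOrbit a 0 x = x ^ a := by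
  have h := congrArg (coeff 0) (stumpffRatio_self a)
  rw [stumpffRatio, coeff_mul, Nat.antidiagonal_zero, sum_singleton, coeff_zero_one] at h
  simp only [stumpffOrbit, Nat.antidiagonal_zero, sum_singleton, h]
  simp

theorem integral_stumpffOrbit_mul (a m : ℕ) {w : ℝ → ℝ} (hw : Continuous w) :
    ∫ x in (0 : ℝ)..1, stumpffOrbit a m x * w x = ∑ p ∈ antidiagonal m,
      ((coeff p.1 (stumpff a)⁻¹ * coeff p.2 (stumpff a) : ℚ) : ℝ) *
        ∫ x in (0 : ℝ)..1, x ^ (2 * p.2 + a) * w x := by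
  simp only [stumpffOrbit, sum_mul, mul_assoc, ← intervalIntegral.integral_const_mul]
  exact intervalIntegral.integral_finsetSum fun p _ =>
    Continuous.intervalIntegrable (by fun_prop) _ _

theorem integral_stumpffOrbit (a m : ℕ) :
    ∫ x in (0 : ℝ)..1, stumpffOrbit a m x = coeff m (stumpffRatio a (a + 1)) := by
  have h := integral_stumpffOrbit_mul a m (w := fun _ => 1) continuous_const
  simp only [mul_one, integral_pow] at h
  rw [h, stumpffRatio, coeff_mul, Rat.cast_sum]
  refine sum_congr rfl fun p _ => ?_
  rw [coeff_stumpff_succ_right, one_pow, zero_pow (Nat.succ_ne_zero _)]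
  push_cast
  ring

theorem integral_stumpffOrbit_mul_one_sub (a m : ℕ) :
    ∫ x in (0 : ℝ)..1, stumpffOrbit a m x * (1 - x) = coeff m (stumpffRatio a (a + 2)) := by
  rw [integral_stumpffOrbit_mul a m (by fun_prop), stumpffRatio, coeff_mul, Rat.cast_sum]
  refine sum_congr rfl fun p _ => ?_
  rw [integral_pow_mul_one_sub, coeff_stumpff_add_two]
  push_cast
  ring

theorem isTransferOrbit_stumpffOrbit {a : ℕ} {k : ℝ → ℝ → ℝ} (hk : ∀ y, Continuous (k · y))
    (hmoment : ∀ (n : ℕ) (y : I), ∫ x in (0 : ℝ)..1, x ^ n * k x y =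
      ((y : ℝ) ^ a - (y : ℝ) ^ (n + 2)) / ((n + 1) * (n + 2))) :
    IsTransferOrbit k (stumpffOrbit a) where
  continuous := continuous_stumpffOrbit a
  integral_mul m y := by
    have hcoeff : ∑ p ∈ antidiagonal (m + 1),
        coeff p.1 (stumpff a)⁻¹ * coeff p.2 (stumpff a) = 0 := by
      rw [← coeff_mul, ← stumpffRatio, stumpffRatio_self, coeff_one, if_neg m.succ_ne_zero]
    rw [Nat.sum_antidiagonal_succ'] at hcoeff
    rw [integral_stumpffOrbit_mul a m (hk y), stumpffOrbit, Nat.sum_antidiagonal_succ',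
      eq_neg_of_add_eq_zero_left hcoeff, mul_zero, zero_add, Rat.cast_neg, Rat.cast_sum, neg_mul,
      sum_mul, ← sum_neg_distrib, ← sum_add_distrib]
    refine sum_congr rfl fun p _ => ?_
    rw [hmoment, coeff_succ_stumpff, coeff_stumpff_add_two]
    push_cast
    ring

theorem isTransferOrbit_peakKernel : IsTransferOrbit peakKernel (stumpffOrbit 0) :=
  isTransferOrbit_stumpffOrbit (fun _ => continuous_peakKernel.uncurry_right _)
    fun n y => by rw [pow_zero, integral_pow_mul_peakKernel]

theorem isTransferOrbit_stripKernel : IsTransferOrbit stripKernel (stumpffOrbit 1) :=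
  isTransferOrbit_stumpffOrbit (fun _ => continuous_stripKernel.uncurry_right _)
    fun n y => by rw [pow_one, integral_pow_mul_stripKernel]

theorem stumpffOrbit_one_zero (x : ℝ) : stumpffOrbit 1 0 x = x := by
  rw [stumpffOrbit_zero, pow_one]

theorem eulerNumber_two_mul_add_one_eq_coeff (m : ℕ) : (eulerNumber (2 * m + 1) : ℚ) =
    (2 * m + 1).factorial * coeff m (stumpffRatio 0 1) := by
  have h := eulerNumber_two_mul_add_one_eq_integral isTransferOrbit_peakKernel
    (fun x => by rw [stumpffOrbit_zero, pow_zero]) m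
  rw [integral_stumpffOrbit] at h
  exact_mod_cast h

theorem fSigma1_succ_eq_coeff (m : ℕ) :
    (fSigma1 (m + 1) : ℚ) = (3 * m + 2).factorial * coeff m (stumpffRatio 1 2) := by
  have h := fSigma1_succ_eq_integral isTransferOrbit_stripKernel
    (fun x => stumpffOrbit_one_zero x) m
  rw [integral_stumpffOrbit] at h
  exact_mod_cast h

theorem fSigma0_succ_eq_coeff (m : ℕ) :
    (fSigma0 (m + 1) : ℚ) = (3 * m + 3).factorial * coeff m (stumpffRatio 1 3) := by
  have h := fSigma0_succ_eq_integral isTransferOrbit_stripKernel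
    (fun x => stumpffOrbit_one_zero x) m
  rw [integral_stumpffOrbit_mul_one_sub] at h
  exact_mod_cast h

theorem fSigma2_succ_eq_coeff (m : ℕ) :
    (fSigma2 (m + 1) : ℚ) = (3 * m + 1).factorial * (2 * coeff m (stumpffRatio 1 2)) := by
  -- The constant `1` is the sum of `x` and its reflection `1 - x`.
  have horbit := isTransferOrbit_stripKernel.add
    (isTransferOrbit_stripKernel.reflect stripKernel_one_sub_one_sub)
    fun _ => continuous_stripKernel.uncurry_right _
  have hint := (continuous_stumpffOrbit 1 m).intervalIntegrable (μ := volume) 0 1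
  have h := fSigma2_succ_eq_integral horbit (fun x => by simp [stumpffOrbit_one_zero]) m
  simp only [Pi.add_apply] at h
  rw [intervalIntegral.integral_add hint (by simpa using (hint.comp_sub_left 1).symm),
    intervalIntegral.integral_comp_sub_left, sub_self, sub_zero, integral_stumpffOrbit,
    ← two_mul] at h
  exact_mod_cast h

end Stumpff

section FormalTrigonometry

open PowerSeries

theorem constantCoeff_rescale {R : Type*} [CommSemiring R] (a : R) (f : PowerSeries R) :
    constantCoeff (rescale a f) = constantCoeff f := by
  rw [← coeff_zero_eq_constantCoeff_apply, coeff_rescale, pow_zero, one_mul,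
    coeff_zero_eq_constantCoeff_apply]

theorem derivative_rescale {R : Type*} [CommSemiring R] (a : R) (f : PowerSeries R) :
    d⁄dX R (rescale a f) = C a * rescale a (d⁄dX R f) := by
  ext n
  simp only [coeff_derivative, coeff_rescale, coeff_C_mul]
  ring

section RatAlgebra

variable (A : Type*) [CommRing A] [Algebra ℚ A]

theorem constantCoeff_sin : constantCoeff (sin A) = 0 := by
  simp [← coeff_zero_eq_constantCoeff_apply, sin]

theorem constantCoeff_cos : constantCoeff (cos A) = 1 := by
  simp [← coeff_zero_eq_constantCoeff_apply, cos]

theorem succ_mul_inv_factorial (r : ℚ) (n : ℕ) :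
    algebraMap ℚ A (r / (n + 1).factorial) * (n + 1) = algebraMap ℚ A (r / n.factorial) := by
  rw [← Nat.cast_succ, ← map_natCast (algebraMap ℚ A), ← map_mul, Nat.factorial_succ]
  congr 1
  push_cast
  field_simp

theorem derivative_sin : d⁄dX A (sin A) = cos A := by
  ext n
  rw [coeff_derivative, sin, cos, coeff_mk, coeff_mk]
  rcases n.even_or_odd with hn | hn
  · rw [if_neg (by simpa [parity_simps] using hn), if_pos hn, succ_mul_inv_factorial,
      show (n + 1) / 2 = n / 2 by grind]
  · rw [if_pos hn.add_one, if_neg (Nat.not_even_iff_odd.2 hn), zero_mul]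

theorem derivative_cos : d⁄dX A (cos A) = -sin A := by
  ext n
  rw [coeff_derivative, map_neg, sin, cos, coeff_mk, coeff_mk]
  rcases n.even_or_odd with hn | hn
  · rw [if_neg (by simpa [parity_simps] using hn), if_pos hn, zero_mul, neg_zero]
  · rw [if_pos hn.add_one, if_neg (Nat.not_even_iff_odd.2 hn), succ_mul_inv_factorial,
      show (n + 1) / 2 = n / 2 + 1 by grind, pow_succ, mul_neg_one, neg_div, map_neg]

variable {A}

theorem sin_sq_add_cos_sq : sin A ^ 2 + cos A ^ 2 = 1 := by
  have := IsAddTorsionFree.of_module_rat A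
  apply derivative.ext
  · simp only [map_add, pow_two, Derivation.leibniz, derivative_sin, derivative_cos, smul_eq_mul,
      derivative_one]
    ring
  · simp [constantCoeff_sin, constantCoeff_cos]

theorem eq_rescale_cos_add_rescale_sin {a : A} {f g : PowerSeries A} (hf : d⁄dX A f = C a * g)
    (hg : d⁄dX A g = -(C a * f)) :
    f = C (constantCoeff f) * rescale a (cos A) + C (constantCoeff g) * rescale a (sin A) := by
  have := IsAddTorsionFree.of_module_rat A
  have hcos : f * rescale a (cos A) - g * rescale a (sin A) = C (constantCoeff f) := by
    apply derivative.ext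
    · simp only [map_sub, map_neg, Derivation.leibniz, smul_eq_mul, hf, hg, derivative_rescale,
        derivative_sin, derivative_cos, derivative_C]
      ring
    · simp [constantCoeff_rescale, constantCoeff_sin, constantCoeff_cos]
  have hsin : f * rescale a (sin A) + g * rescale a (cos A) = C (constantCoeff g) := by
    apply derivative.ext
    · simp only [map_add, map_neg, Derivation.leibniz, smul_eq_mul, hf, hg, derivative_rescale,
        derivative_sin, derivative_cos, derivative_C]
      ring
    · simp [constantCoeff_rescale, constantCoeff_sin, constantCoeff_cos]
  have hsq := congrArg (rescale a) (sin_sq_add_cos_sq (A := A))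
  simp only [map_add, map_pow, map_one] at hsq
  linear_combination rescale a (cos A) * hcos + rescale a (sin A) * hsin - f * hsq

theorem derivative_two_mul_sin_mul_cos :
    d⁄dX A (2 * sin A * cos A) = C 2 * (cos A ^ 2 - sin A ^ 2) := by
  rw [← map_ofNat C 2]
  simp only [Derivation.leibniz, derivative_sin, derivative_cos, derivative_C, smul_eq_mul]
  ring

theorem derivative_cos_sq_sub_sin_sq :
    d⁄dX A (cos A ^ 2 - sin A ^ 2) = -(C 2 * (2 * sin A * cos A)) := by
  rw [map_ofNat C 2]
  simp only [map_sub, pow_two, Derivation.leibniz, derivative_sin, derivative_cos, smul_eq_mul]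
  ring

theorem rescale_two_sin : rescale 2 (sin A) = 2 * sin A * cos A := by
  rw [eq_rescale_cos_add_rescale_sin derivative_two_mul_sin_mul_cos derivative_cos_sq_sub_sin_sq]
  simp [constantCoeff_sin, constantCoeff_cos]

theorem rescale_two_cos : rescale 2 (cos A) = cos A ^ 2 - sin A ^ 2 := by
  have hneg : d⁄dX A (-(2 * sin A * cos A)) = -(C 2 * (cos A ^ 2 - sin A ^ 2)) := by
    rw [map_neg, derivative_two_mul_sin_mul_cos]
  rw [eq_rescale_cos_add_rescale_sin (derivative_cos_sq_sub_sin_sq.trans (mul_neg _ _).symm) hneg]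
  simp [constantCoeff_sin, constantCoeff_cos]

theorem sin_ne_zero [Nontrivial A] : sin A ≠ 0 := fun h => by
  have := congrArg constantCoeff (derivative_sin A)
  simp [h, constantCoeff_cos] at this

theorem rescale_cos_ne_zero [Nontrivial A] (a : A) : rescale a (cos A) ≠ 0 := fun h => by
  have := congrArg constantCoeff h
  simp [constantCoeff_rescale, constantCoeff_cos] at this

end RatAlgebra

end FormalTrigonometry

section GeneratingFunctions

open PowerSeries

theorem expand_stumpff_zero : expand 2 two_ne_zero (stumpff 0) = cos ℚ := by
  ext n
  simp only [coeff_expand, stumpff, cos, coeff_mk, even_iff_two_dvd, Algebra.algebraMap_self,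
    RingHom.id_apply, add_zero]
  split_ifs with hn
  · rw [Nat.mul_div_cancel' hn]
  · rfl

theorem X_mul_expand_stumpff_one : X * expand 2 two_ne_zero (stumpff 1) = sin ℚ := by
  ext (_ | n)
  · rw [coeff_zero_X_mul, coeff_zero_eq_constantCoeff_apply, constantCoeff_sin]
  · simp only [coeff_succ_X_mul, coeff_expand, stumpff, sin, coeff_mk, even_iff_two_dvd,
      Algebra.algebraMap_self, RingHom.id_apply]
    split_ifs with hn hn' hn'
    · omega
    · rw [Nat.mul_div_cancel' hn, Nat.succ_div_of_not_dvd hn']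
    · rfl
    · omega

theorem X_mul_stumpff_add_two (a : ℕ) :
    X * stumpff (a + 2) = C ((a.factorial : ℚ)⁻¹) - stumpff a := by
  ext (_ | n)
  · simp [stumpff]
  · rw [map_sub, coeff_succ_X_mul, coeff_C, if_neg n.succ_ne_zero, coeff_succ_stumpff]
    ring

theorem X_sq_mul_expand_stumpff_add_two (a : ℕ) :
    X ^ 2 * expand 2 two_ne_zero (stumpff (a + 2)) =
      C ((a.factorial : ℚ)⁻¹) - expand 2 two_ne_zero (stumpff a) := by
  rw [← expand_X 2 two_ne_zero, ← map_mul, X_mul_stumpff_add_two, map_sub, expand_C]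

theorem expand_stumpffRatio_mul (a b : ℕ) :
    expand 2 two_ne_zero (stumpffRatio a b) * expand 2 two_ne_zero (stumpff a) =
      expand 2 two_ne_zero (stumpff b) := by
  rw [← map_mul, stumpffRatio_mul_stumpff]

theorem stumpffRatio_zero_one_mul_cos :
    X * expand 2 two_ne_zero (stumpffRatio 0 1) * cos ℚ = sin ℚ := by
  rw [mul_assoc, ← expand_stumpff_zero, expand_stumpffRatio_mul, X_mul_expand_stumpff_one]

theorem stumpffRatio_one_mul_sin (a : ℕ) :
    X ^ 2 * expand 2 two_ne_zero (stumpffRatio 1 (a + 2)) * sin ℚ =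
      X * (C ((a.factorial : ℚ)⁻¹) - expand 2 two_ne_zero (stumpff a)) := by
  rw [← X_sq_mul_expand_stumpff_add_two, ← expand_stumpffRatio_mul 1, ← X_mul_expand_stumpff_one]
  ring

theorem stumpffRatio_one_two_mul_sin :
    X ^ 2 * expand 2 two_ne_zero (stumpffRatio 1 2) * sin ℚ = X * (1 - cos ℚ) := by
  rw [stumpffRatio_one_mul_sin 0, expand_stumpff_zero]
  simp

theorem stumpffRatio_one_three_mul_sin :
    X ^ 2 * expand 2 two_ne_zero (stumpffRatio 1 3) * sin ℚ = X - sin ℚ := by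
  rw [stumpffRatio_one_mul_sin 1, mul_sub, X_mul_expand_stumpff_one]
  simp

theorem rescale_two_stumpffRatio_one_two_mul_cos :
    rescale 2 (X ^ 2 * expand 2 two_ne_zero (stumpffRatio 1 2)) * cos ℚ = 2 * X * sin ℚ := by
  have : CharZero (PowerSeries ℚ) := algebraRat.charZero _
  have h := congrArg (rescale 2) stumpffRatio_one_two_mul_sin
  rw [map_mul, map_mul _ X, map_sub, map_one, rescale_X, rescale_two_sin, rescale_two_cos,
    map_ofNat C] at h
  refine mul_right_cancel₀ (mul_ne_zero two_ne_zero sin_ne_zero) ?_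
  linear_combination h - 2 * X * sin_sq_add_cos_sq (A := ℚ)

theorem stumpffRatio_one_two_mul_rescale_half_cos :
    X ^ 2 * expand 2 two_ne_zero (stumpffRatio 1 2) * rescale (1 / 2) (cos ℚ) =
      X * rescale (1 / 2) (sin ℚ) := by
  have htwo : rescale (1 / 2 : ℚ) (2 * X) = X := by
    rw [map_mul, map_ofNat, rescale_X, ← map_ofNat C 2, ← mul_assoc, ← map_mul,
      mul_one_div_cancel two_ne_zero, map_one, one_mul]
  have h := congrArg (rescale (1 / 2 : ℚ)) rescale_two_stumpffRatio_one_two_mul_cos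
  rwa [map_mul, map_mul _ (2 * X), htwo, rescale_rescale, mul_one_div_cancel two_ne_zero,
    rescale_one, RingHom.id_apply] at h

theorem coeff_two_mul_add_two_X_sq_mul_expand (r : PowerSeries ℚ) (m : ℕ) :
    coeff (2 * m + 2) (X ^ 2 * expand 2 two_ne_zero r) = coeff m r := by
  rw [coeff_X_pow_mul, coeff_expand_mul]

theorem coeff_stumpffRatio_one_two (m : ℕ) :
    coeff m (stumpffRatio 1 2) = coeff m (stumpffRatio 0 1) / 2 ^ (2 * m + 1) := by
  have h : rescale 2 (X ^ 2 * expand 2 two_ne_zero (stumpffRatio 1 2)) =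
      C 2 * (X ^ 2 * expand 2 two_ne_zero (stumpffRatio 0 1)) := by
    have hcos : cos ℚ ≠ 0 := by simpa using rescale_cos_ne_zero (1 : ℚ)
    refine mul_right_cancel₀ hcos ?_
    rw [rescale_two_stumpffRatio_one_two_mul_cos, ← stumpffRatio_zero_one_mul_cos, map_ofNat C]
    ring
  have hcoeff := congrArg (coeff (2 * m + 2)) h
  rw [coeff_rescale, coeff_C_mul, coeff_two_mul_add_two_X_sq_mul_expand,
    coeff_two_mul_add_two_X_sq_mul_expand, pow_succ 2 (2 * m + 1)] at hcoeff
  rw [eq_div_iff (by positivity)]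
  linear_combination hcoeff / 2

theorem coeff_stumpffRatio_one_three (m : ℕ) :
    (2 ^ (2 * m + 2) - 1) * coeff m (stumpffRatio 1 3) =
      (2 ^ (2 * m + 1) - 1) * coeff m (stumpffRatio 1 2) := by
  set F := X ^ 2 * expand 2 two_ne_zero (stumpffRatio 1 2) with hF
  set G := X ^ 2 * expand 2 two_ne_zero (stumpffRatio 1 3) with hG
  have hFsin : F * sin ℚ = X * (1 - cos ℚ) := stumpffRatio_one_two_mul_sin
  have hFcos : rescale 2 F * cos ℚ = 2 * X * sin ℚ := rescale_two_stumpffRatio_one_two_mul_cos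
  have hGsin : G * sin ℚ = X - sin ℚ := stumpffRatio_one_three_mul_sin
  have hGsin_two : rescale 2 G * (2 * sin ℚ * cos ℚ) = 2 * X - 2 * sin ℚ * cos ℚ := by
    simpa only [map_mul, map_sub, rescale_X, rescale_two_sin, map_ofNat C] using
      congrArg (rescale 2) hGsin
  have h : C 2 * (rescale 2 G - G) = rescale 2 F - C 2 * F := by
    refine mul_right_cancel₀ (mul_ne_zero sin_ne_zero (rescale_cos_ne_zero (1 : ℚ))) ?_
    rw [rescale_one, RingHom.id_apply, map_ofNat C]
    linear_combination hGsin_two - 2 * cos ℚ * hGsin - sin ℚ * hFcos + 2 * cos ℚ * hFsin -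
      2 * X * sin_sq_add_cos_sq (A := ℚ)
  have hcoeff := congrArg (coeff (2 * m + 2)) h
  simp only [coeff_C_mul, map_sub, coeff_rescale, hF, hG,
    coeff_two_mul_add_two_X_sq_mul_expand] at hcoeff
  rw [pow_succ 2 (2 * m + 1)] at hcoeff ⊢
  linear_combination hcoeff / 2

theorem evenSeries_eq_X_sq_mul_expand {c : ℕ → ℚ} {r : PowerSeries ℚ}
    (h : ∀ m, c (m + 1) = coeff m r) : evenSeries c = X ^ 2 * expand 2 two_ne_zero r := by
  ext n
  obtain ⟨k, rfl | rfl⟩ := n.even_or_odd'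
  · rcases k with _ | m
    · simp [evenSeries, coeff_X_pow_mul']
    · rw [mul_add_one, coeff_two_mul_add_two_X_sq_mul_expand, ← h, evenSeries, coeff_mk,
        if_pos ⟨by simp [parity_simps], by omega⟩, show (2 * m + 2) / 2 = m + 1 by omega]
  · rw [evenSeries, coeff_mk, if_neg (by simp [parity_simps]), coeff_X_pow_mul', coeff_expand]
    grind

theorem evenSeries_fSigma1_mul_rescale_half_cos :
    evenSeries (fun n => fSigma1 n / (3 * n - 1).factorial) * rescale (1 / 2) (cos ℚ) =
      X * rescale (1 / 2) (sin ℚ) := by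
  rw [evenSeries_eq_X_sq_mul_expand (r := stumpffRatio 1 2) fun m => ?_,
    stumpffRatio_one_two_mul_rescale_half_cos]
  rw [fSigma1_succ_eq_coeff, show 3 * (m + 1) - 1 = 3 * m + 2 by omega,
    mul_div_cancel_left₀ _ (by positivity)]

theorem evenSeries_fSigma0_add_one_mul_sin :
    (evenSeries (fun n => fSigma0 n / (3 * n).factorial) + 1) * sin ℚ = X := by
  rw [evenSeries_eq_X_sq_mul_expand (r := stumpffRatio 1 3) fun m => ?_, add_mul,
    stumpffRatio_one_three_mul_sin, one_mul, sub_add_cancel]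
  rw [fSigma0_succ_eq_coeff, mul_add_one 3 m, mul_div_cancel_left₀ _ (by positivity)]

theorem coe_eq_div_of_mul_eq {K : Type*} [Field K] {f g h : PowerSeries K} (hg : g ≠ 0)
    (hfg : f * g = h) : (f : LaurentSeries K) = h / g := by
  have hg' : (g : LaurentSeries K) ≠ 0 :=
    (map_ne_zero_iff _ HahnSeries.ofPowerSeries_injective).2 hg
  rw [eq_div_iff hg', ← PowerSeries.coe_mul, hfg]

end GeneratingFunctions

section ClosedForms

theorem fSigma2_eq {n : ℕ} (hn : 1 ≤ n) : (fSigma2 n : ℚ) =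
    (3 * n - 2).factorial * eulerNumber (2 * n - 1) /
      ((2 * n - 1).factorial * 2 ^ (2 * n - 2)) := by
  obtain ⟨m, rfl⟩ := Nat.exists_eq_add_of_le' hn
  rw [show 3 * (m + 1) - 2 = 3 * m + 1 by omega, show 2 * (m + 1) - 1 = 2 * m + 1 by omega,
    show 2 * (m + 1) - 2 = 2 * m by omega, fSigma2_succ_eq_coeff,
    eulerNumber_two_mul_add_one_eq_coeff, coeff_stumpffRatio_one_two]
  field_simp
  ring

theorem fSigma1_eq {n : ℕ} (hn : 1 ≤ n) : (fSigma1 n : ℚ) =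
    (3 * n - 1).factorial * eulerNumber (2 * n - 1) /
      ((2 * n - 1).factorial * 2 ^ (2 * n - 1)) := by
  obtain ⟨m, rfl⟩ := Nat.exists_eq_add_of_le' hn
  rw [show 3 * (m + 1) - 1 = 3 * m + 2 by omega, show 2 * (m + 1) - 1 = 2 * m + 1 by omega,
    fSigma1_succ_eq_coeff, eulerNumber_two_mul_add_one_eq_coeff, coeff_stumpffRatio_one_two]
  field_simp

theorem fSigma0_eq {n : ℕ} (hn : 1 ≤ n) : (fSigma0 n : ℚ) =
    (3 * n).factorial * (2 ^ (2 * n - 1) - 1) * eulerNumber (2 * n - 1) /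
      ((2 * n - 1).factorial * 2 ^ (2 * n - 1) * (2 ^ (2 * n) - 1)) := by
  obtain ⟨m, rfl⟩ := Nat.exists_eq_add_of_le' hn
  have hne : (2 : ℚ) ^ (2 * m + 2) - 1 ≠ 0 :=
    (sub_pos.2 (one_lt_pow₀ one_lt_two (by omega))).ne'
  rw [show 2 * (m + 1) - 1 = 2 * m + 1 by omega, mul_add_one 3 m, mul_add_one 2 m,
    fSigma0_succ_eq_coeff, eulerNumber_two_mul_add_one_eq_coeff,
    eq_div_of_mul_eq hne ((mul_comm _ _).trans (coeff_stumpffRatio_one_three m)),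
    coeff_stumpffRatio_one_two]
  field_simp

end ClosedForms

end ThreeStrip

theorem theorem1 :
    (∀ n : ℕ, 1 ≤ n →
      (ThreeStrip.fSigma2 n : ℚ) =
          (Nat.factorial (3 * n - 2) : ℚ) * (ThreeStrip.eulerNumber (2 * n - 1) : ℚ) /
            ((Nat.factorial (2 * n - 1) : ℚ) * 2 ^ (2 * n - 2)) ∧
      (ThreeStrip.fSigma1 n : ℚ) =
          (Nat.factorial (3 * n - 1) : ℚ) * (ThreeStrip.eulerNumber (2 * n - 1) : ℚ) /
            ((Nat.factorial (2 * n - 1) : ℚ) * 2 ^ (2 * n - 1)) ∧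
      (ThreeStrip.fSigma0 n : ℚ) =
          (Nat.factorial (3 * n) : ℚ) * ((2 : ℚ) ^ (2 * n - 1) - 1) *
              (ThreeStrip.eulerNumber (2 * n - 1) : ℚ) /
            ((Nat.factorial (2 * n - 1) : ℚ) * 2 ^ (2 * n - 1) * ((2 : ℚ) ^ (2 * n) - 1))) ∧
    -- the generating functions, as identities in the field of formal Laurent series over `ℚ`
    ((ThreeStrip.evenSeries
          (fun n => (ThreeStrip.fSigma1 n : ℚ) / (Nat.factorial (3 * n - 1) : ℚ)) :
          PowerSeries ℚ) : LaurentSeries ℚ) =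
      ((PowerSeries.X : PowerSeries ℚ) : LaurentSeries ℚ) *
        (((PowerSeries.rescale (1 / 2 : ℚ) (PowerSeries.sin ℚ) : PowerSeries ℚ) :
            LaurentSeries ℚ) /
          ((PowerSeries.rescale (1 / 2 : ℚ) (PowerSeries.cos ℚ) : PowerSeries ℚ) :
            LaurentSeries ℚ)) ∧
    ((ThreeStrip.evenSeries
          (fun n => (ThreeStrip.fSigma0 n : ℚ) / (Nat.factorial (3 * n) : ℚ)) :
          PowerSeries ℚ) : LaurentSeries ℚ) =
      ((PowerSeries.X : PowerSeries ℚ) : LaurentSeries ℚ) /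
          ((PowerSeries.sin ℚ : PowerSeries ℚ) : LaurentSeries ℚ) - 1 := by
  refine ⟨fun n hn => ⟨ThreeStrip.fSigma2_eq hn, ThreeStrip.fSigma1_eq hn,
    ThreeStrip.fSigma0_eq hn⟩, ?_, ?_⟩
  · rw [← mul_div_assoc, ← PowerSeries.coe_mul]
    exact ThreeStrip.coe_eq_div_of_mul_eq (ThreeStrip.rescale_cos_ne_zero _)
      ThreeStrip.evenSeries_fSigma1_mul_rescale_half_cos
  · rw [eq_sub_iff_add_eq, ← PowerSeries.coe_one, ← PowerSeries.coe_add]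
    exact ThreeStrip.coe_eq_div_of_mul_eq ThreeStrip.sin_ne_zero
      ThreeStrip.evenSeries_fSigma0_add_one_mul_sin
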